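/- Let $n\ge 0$ be an integer, let $\mathbb S^n$ be the space of real symmetric $n\times n$ matrices, let $\mathbb S^n_{++}\subset\mathbb S^n$ be the open subset of positive definite matrices, and fix $M\in\mathbb S^n_{++}$. For $X\in\mathbb S^n_{++}$ and $U\in\mathbb S^n$ let $\mathcal L_{X,M}[U]\in\mathbb S^n$ be the unique solution $L$ of $XLM+MLX=U$. The generalized Bures--Wasserstein (GBW) metric on $\mathbb S^n_{++}$ is the Riemannian metric $g_X(U,V)=\tfrac12\operatorname{tr}(\mathcal L_{X,M}[U]\,V)$, $U,V\in T_X\mathbb S^n_{++}=\mathbb S^n$. Let $\pi(P)=M^{1/2}PP^\top M^{1/2}$ for $P\in\mathrm{GL}(n)$; a matrix $V\in\mathbb R^{n\times n}=T_P\mathrm{GL}(n)$ is called horizontal at $P$ if $\operatorname{tr}(U^\top V)=0$ for every $U\in\ker D\pi(P)$. Let $X,Y\in\mathbb S^n_{++}$, let $O$ be the orthogonal polar factor of the invertible matrix $A=Y^{1/2}M^{-1}X^{1/2}$, that is $O=A(A^\top A)^{-1/2}$ (so that $O$ is orthogonal and $A=OP$ with $P$ symmetric positive definite), and put $$c(t)=(1-t)\,M^{-1/2}X^{1/2}+t\,M^{-1/2}Y^{1/2}O,\qquad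 \gamma(t)=\pi(c(t)).$$ Then $c(t)\in\mathrm{GL}(n)$ and $c'(t)$ is horizontal at $c(t)$ for all $t\in[0,1]$, and $\gamma:[0,1]\to\mathbb S^n_{++}$ is a geodesic of the GBW metric (that is, a smooth curve with $\nabla_{\gamma'}\gamma'=0$ for the Levi-Civita connection $\nabla$ of $g$) with $\gamma(0)=X$ and $\gamma(1)=Y$. Moreover, $$\gamma(t)=\big((1-t)X^{1/2}+tY^{1/2}O\big)\big((1-t)X^{1/2}+tY^{1/2}O\big)^\top .$$ -/

import Mathlib

open scoped Matrix MatrixOrder ContDiff Matrix.Norms.L2Operator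

/- The scoped norm on matrices (the operator norm) only serves to make derivatives of matrix-valued
maps available; all norms are equivalent here, and none of the definitions depends on the choice. -/

noncomputable section

/-! ### Riemannian metrics on open subsets of a vector space and their geodesics -/

/-- A smooth Riemannian metric on an open subset `U` of a finite-dimensional real vector space `E`
(all tangent spaces being identified with `E`): `inner x` is the inner product on the tangent space
at `x`. Only its values at points of `U` matter. -/
structure OpenRiemannianMetric {E : Type*} [NormedAddCommGroup E] [NormedSpace ℝ E]
    [FiniteDimensional ℝ E] (U : TopologicalSpace.Opens E) where
  inner : E → E →L[ℝ] E →L[ℝ] ℝ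
  symm : ∀ x ∈ U, ∀ v w, inner x v w = inner x w v
  pos : ∀ x ∈ U, ∀ v, v ≠ 0 → 0 < inner x v v
  smooth : ContDiffOn ℝ ∞ inner (U : Set E)

namespace OpenRiemannianMetric

variable {E : Type*} [NormedAddCommGroup E] [NormedSpace ℝ E] [FiniteDimensional ℝ E]
  {U : TopologicalSpace.Opens E}

/-- Christoffel symbols of the first kind: the covector
`w ↦ (1/2) (∂_u g (v, w) + ∂_v g (u, w) - ∂_w g (u, v))` at the point `x`. -/
def christoffelFirst (g : OpenRiemannianMetric U) (x u v : E) : E →L[ℝ] ℝ :=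
  (1 / 2 : ℝ) • (fderiv ℝ g.inner x u v + fderiv ℝ g.inner x v u
    - ((fderiv ℝ g.inner x).flip u).flip v)

/-- Christoffel symbols of the second kind, i.e. those of the Levi-Civita connection: the vector
`Γ_x(u, v)` obtained from `christoffelFirst` by raising the index, so that
`g_x (Γ_x(u, v), w) = (1/2) (∂_u g (v, w) + ∂_v g (u, w) - ∂_w g (u, v))` for all `w`
(see `inner_christoffel`). -/
def christoffel (g : OpenRiemannianMetric U) (x u v : E) : E :=
  (g.inner x).inverse (g.christoffelFirst x u v)

theorem inner_christoffel (g : OpenRiemannianMetric U) {x : E} (hx : x ∈ U) (u v w : E) :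
    g.inner x (g.christoffel x u v) w = (1 / 2) * (fderiv ℝ g.inner x u v w
      + fderiv ℝ g.inner x v u w - fderiv ℝ g.inner x w u v) := by
  have hinj : Function.Injective (g.inner x).toLinearMap := by
    rw [injective_iff_map_eq_zero]
    intro a ha
    by_contra h0
    have h1 : g.inner x a = 0 := ha
    have h2 := g.pos x hx a h0
    rw [h1] at h2
    exact lt_irrefl _ h2
  have hdim : Module.finrank ℝ E = Module.finrank ℝ (E →L[ℝ] ℝ) := by
    rw [← (LinearMap.toContinuousLinearMap (𝕜 := ℝ) (E := E) (F' := ℝ)).finrank_eq]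
    exact (Subspace.dual_finrank_eq (K := ℝ) (V := E)).symm
  have hinv : (g.inner x).IsInvertible :=
    ⟨(LinearEquiv.ofInjectiveOfFinrankEq _ hinj hdim).toContinuousLinearEquiv, by ext1; rfl⟩
  have h := congrArg (fun f : E →L[ℝ] ℝ => f w)
    (hinv.self_apply_inverse (g.christoffelFirst x u v))
  exact h

/-- The curve `γ`, restricted to `I`, is a geodesic of `(U, g)`: it is a smooth curve in `U` whose
velocity is parallel along it for the Levi-Civita connection, `γ'' + Γ_γ(γ', γ') = 0`. Derivatives
are taken within `I`, hence are one-sided at the end points. -/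
structure IsGeodesicOn (g : OpenRiemannianMetric U) (γ : ℝ → E) (I : Set ℝ) : Prop where
  mem : ∀ t ∈ I, γ t ∈ U
  smooth : ContDiffOn ℝ ∞ γ I
  geodesic_eq : ∀ t ∈ I, derivWithin (derivWithin γ I) I t
    + g.christoffel (γ t) (derivWithin γ I t) (derivWithin γ I t) = 0

end OpenRiemannianMetric

/-! ### The manifold of symmetric positive definite matrices -/

/-- The space `𝕊ⁿ` of real symmetric `n × n` matrices. -/
def SymMat (n : ℕ) : Submodule ℝ (Matrix (Fin n) (Fin n) ℝ) where
  carrier := {A | A.IsSymm}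
  add_mem' ha hb := Matrix.IsSymm.add ha hb
  zero_mem' := Matrix.isSymm_zero
  smul_mem' c _ ha := Matrix.IsSymm.smul ha c

theorem isOpen_posDef_symMat (n : ℕ) :
    IsOpen {X : SymMat n | (X : Matrix (Fin n) (Fin n) ℝ).PosDef} := by
  have h : ∀ X : SymMat n, X.1.PosDef ↔
      ∀ v ∈ Metric.sphere (0 : Fin n → ℝ) 1, 0 < v ⬝ᵥ X.1 *ᵥ v := by
    intro X
    constructor
    · intro hX v hv
      have hv0 : v ≠ 0 := by
        rintro rfl
        simp at hv
      simpa using hX.dotProduct_mulVec_pos hv0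
    · intro hX
      have hXt : X.1.IsHermitian := by
        have : X.1ᵀ = X.1 := X.2
        simpa [Matrix.IsHermitian] using this
      refine Matrix.PosDef.of_dotProduct_mulVec_pos hXt fun v hv => ?_
      have hn : 0 < ‖v‖ := norm_pos_iff.2 hv
      have h1 := hX (‖v‖⁻¹ • v) (by simp [norm_smul, hn.ne'])
      rw [Matrix.mulVec_smul, dotProduct_smul, smul_dotProduct, smul_eq_mul, smul_eq_mul] at h1
      have h2 : 0 < ‖v‖⁻¹ := inv_pos.2 hn
      simpa using pos_of_mul_pos_right (pos_of_mul_pos_right h1 h2.le) h2.le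
  rw [isOpen_iff_mem_nhds]
  intro X hX
  have hK : IsCompact (Metric.sphere (0 : Fin n → ℝ) 1) := isCompact_sphere _ _
  have hc : Continuous fun p : SymMat n × (Fin n → ℝ) => p.2 ⬝ᵥ p.1.1 *ᵥ p.2 := by
    fun_prop
  have := hK.eventually_forall_of_forall_eventually (x₀ := X)
    (P := fun (Z : SymMat n) v => 0 < v ⬝ᵥ Z.1 *ᵥ v)
    fun v hv => (hc.tendsto (X, v)).eventually_const_lt ((h X).1 hX v hv)
  filter_upwards [this] with Z hZ using (h Z).2 hZ

/-- The manifold `𝕊ⁿ₊₊` of symmetric positive definite matrices, an open subset of `𝕊ⁿ`. -/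
def SPD (n : ℕ) : TopologicalSpace.Opens (SymMat n) :=
  ⟨{X | (X : Matrix (Fin n) (Fin n) ℝ).PosDef}, isOpen_posDef_symMat n⟩

/-! ### The generalized Bures-Wasserstein metric -/

/-- The linear map `L ↦ X L M + M L X` on symmetric matrices, for symmetric `X` and `M`. -/
def lyapunovMap {n : ℕ} (M X : SymMat n) : SymMat n →L[ℝ] SymMat n :=
  LinearMap.toContinuousLinearMap
    { toFun := fun L => ⟨X.1 * L.1 * M.1 + M.1 * L.1 * X.1, by
        have hX : X.1ᵀ = X.1 := X.2
        have hM : M.1ᵀ = M.1 := M.2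
        have hL : L.1ᵀ = L.1 := L.2
        change (X.1 * L.1 * M.1 + M.1 * L.1 * X.1)ᵀ = _
        simp only [Matrix.transpose_add, Matrix.transpose_mul, hX, hM, hL, Matrix.mul_assoc]
        exact add_comm _ _⟩
      map_add' := fun A B => by
        ext1
        simp only [Submodule.coe_add, Matrix.mul_add, Matrix.add_mul]
        abel
      map_smul' := fun c A => by
        ext1
        simp [smul_add] }

/-- The generalized Lyapunov operator: for positive definite `M` and `X`, `genLyapunov M X U` is the
unique solution `L` of `X L M + M L X = U` (see `lyapunovMap_genLyapunov`). -/
def genLyapunov {n : ℕ} (M X : SymMat n) : SymMat n →L[ℝ] SymMat n :=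
  (lyapunovMap M X).inverse

/-- The bilinear form `(U, V) ↦ tr (U V)` on symmetric matrices. -/
def traceForm {n : ℕ} : SymMat n →L[ℝ] SymMat n →L[ℝ] ℝ :=
  LinearMap.toContinuousBilinearMap
    (LinearMap.mk₂ ℝ (fun U V : SymMat n => (U.1 * V.1).trace)
      (fun _ _ _ => by simp [Matrix.add_mul]) (fun _ _ _ => by simp)
      (fun _ _ _ => by simp [Matrix.mul_add]) (fun _ _ _ => by simp))

/-- The bilinear form `(U, V) ↦ (1/2) tr (𝓛_{X,M}[U] V)`. -/
def gbwForm {n : ℕ} (M X : SymMat n) : SymMat n →L[ℝ] SymMat n →L[ℝ] ℝ :=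
  (1 / 2 : ℝ) • (traceForm ∘L genLyapunov M X)

theorem gbwForm_apply {n : ℕ} (M X U V : SymMat n) :
    gbwForm M X U V = (1 / 2) * ((genLyapunov M X U).1 * V.1).trace := rfl

theorem genLyapunov_aux_pos {n : ℕ} {M X L : SymMat n} (hM : M.1.PosDef) (hX : X.1.PosDef)
    (hL : L ≠ 0) : 0 < (L.1 * X.1 * L.1 * M.1).trace := by
  set S := CFC.sqrt M.1 with hS
  set R := CFC.sqrt X.1 with hR
  have hSS : S * S = M.1 := CFC.sqrt_mul_sqrt_self _ hM.posSemidef.nonneg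
  have hRR : R * R = X.1 := CFC.sqrt_mul_sqrt_self _ hX.posSemidef.nonneg
  have hSt : Sᴴ = S := (Matrix.nonneg_iff_posSemidef.1 (CFC.sqrt_nonneg M.1)).isHermitian.eq
  have hRt : Rᴴ = R := (Matrix.nonneg_iff_posSemidef.1 (CFC.sqrt_nonneg X.1)).isHermitian.eq
  have hLt : L.1ᴴ = L.1 := by
    have : L.1ᵀ = L.1 := L.2
    simpa using this
  have hSu : IsUnit S := isUnit_of_mul_isUnit_left (hSS ▸ hM.isUnit)
  have hRu : IsUnit R := isUnit_of_mul_isUnit_left (hRR ▸ hX.isUnit)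
  have key : (L.1 * X.1 * L.1 * M.1).trace = ((R * L.1 * S)ᴴ * (R * L.1 * S)).trace := by
    rw [Matrix.conjTranspose_mul, Matrix.conjTranspose_mul, hSt, hRt, hLt, ← hSS, ← hRR,
      Matrix.mul_assoc S, Matrix.trace_mul_comm S]
    simp only [Matrix.mul_assoc]
  rw [key]
  have h0 := (Matrix.posSemidef_conjTranspose_mul_self (R * L.1 * S)).trace_nonneg
  refine lt_of_le_of_ne h0 fun h => hL ?_
  have h1 := Matrix.trace_conjTranspose_mul_self_eq_zero_iff.1 h.symm
  have h2 : R * L.1 = 0 := hSu.mul_left_eq_zero.1 h1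
  exact Subtype.ext ((hRu.mul_right_eq_zero).1 h2)

theorem lyapunovMap_isInvertible {n : ℕ} {M X : SymMat n} (hM : M.1.PosDef) (hX : X.1.PosDef) :
    (lyapunovMap M X).IsInvertible := by
  have hinj : Function.Injective (lyapunovMap M X).toLinearMap := by
    rw [injective_iff_map_eq_zero]
    intro L hL
    by_contra hL0
    have h1 : X.1 * L.1 * M.1 + M.1 * L.1 * X.1 = 0 := congrArg Subtype.val hL
    have h2 : (L.1 * (X.1 * L.1 * M.1 + M.1 * L.1 * X.1)).trace
        = 2 * (L.1 * X.1 * L.1 * M.1).trace := by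
      rw [Matrix.mul_add, Matrix.trace_add, ← Matrix.mul_assoc L.1 (M.1 * L.1) X.1,
        ← Matrix.mul_assoc L.1 M.1 L.1, Matrix.mul_assoc (L.1 * M.1) L.1 X.1,
        Matrix.trace_mul_comm (L.1 * M.1)]
      simp only [Matrix.mul_assoc]
      ring
    rw [h1, Matrix.mul_zero, Matrix.trace_zero] at h2
    linarith [genLyapunov_aux_pos hM hX hL0]
  exact ⟨(LinearEquiv.ofInjectiveEndo _ hinj).toContinuousLinearEquiv, by ext1; rfl⟩

theorem lyapunovMap_genLyapunov {n : ℕ} {M X : SymMat n} (hM : M.1.PosDef) (hX : X.1.PosDef)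
    (U : SymMat n) :
    X.1 * (genLyapunov M X U).1 * M.1 + M.1 * (genLyapunov M X U).1 * X.1 = U.1 := by
  have h := (lyapunovMap_isInvertible hM hX).self_apply_inverse U
  exact congrArg Subtype.val h

theorem gbwForm_eq {n : ℕ} {M X : SymMat n} (hM : M.1.PosDef) (hX : X.1.PosDef)
    (U V : SymMat n) : gbwForm M X U V = (1 / 2) *
      (((genLyapunov M X U).1 * X.1 * (genLyapunov M X V).1 * M.1).trace
        + ((genLyapunov M X V).1 * X.1 * (genLyapunov M X U).1 * M.1).trace) := by
  rw [gbwForm_apply]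
  conv_lhs => rw [← lyapunovMap_genLyapunov hM hX V]
  rw [Matrix.mul_add, Matrix.trace_add, Matrix.trace_mul_comm _ (M.1 * _ * X.1),
    Matrix.mul_assoc (M.1 * _) X.1, Matrix.mul_assoc M.1, Matrix.trace_mul_comm M.1]
  simp only [Matrix.mul_assoc]

theorem contDiff_lyapunovMap {n : ℕ} (M : SymMat n) : ContDiff ℝ ∞ (lyapunovMap M) := by
  refine contDiff_clm_apply_iff.2 fun L => ?_
  let f : SymMat n →ₗ[ℝ] SymMat n :=
    { toFun := fun X => lyapunovMap M X L
      map_add' := fun A B => by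
        ext1
        change (A.1 + B.1) * L.1 * M.1 + M.1 * L.1 * (A.1 + B.1) =
          (A.1 * L.1 * M.1 + M.1 * L.1 * A.1) + (B.1 * L.1 * M.1 + M.1 * L.1 * B.1)
        simp only [Matrix.mul_add, Matrix.add_mul]
        abel
      map_smul' := fun c A => by
        ext1
        change (c • A.1) * L.1 * M.1 + M.1 * L.1 * (c • A.1) =
          c • (A.1 * L.1 * M.1 + M.1 * L.1 * A.1)
        simp [smul_add] }
  exact (LinearMap.toContinuousLinearMap f).contDiff

/-- The generalized Bures-Wasserstein metric on `𝕊ⁿ₊₊` with parameter `M`: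
`g_X(U, V) = (1/2) tr (𝓛_{X,M}[U] V)`. -/
def gbwMetric {n : ℕ} (M : SymMat n) (hM : M.1.PosDef) : OpenRiemannianMetric (SPD n) where
  inner := gbwForm M
  symm X hX U V := by
    rw [gbwForm_eq hM hX, gbwForm_eq hM hX, add_comm]
  pos X hX U hU := by
    have h0 : genLyapunov M X U ≠ 0 := by
      intro h
      apply hU
      have := lyapunovMap_genLyapunov hM hX U
      rw [h] at this
      ext1
      simpa using this.symm
    rw [gbwForm_eq hM hX]
    linarith [genLyapunov_aux_pos hM hX h0]
  smooth := by
    intro X hX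
    obtain ⟨e, he⟩ := lyapunovMap_isInvertible hM hX
    have h1 : ContDiffAt ℝ ∞ (fun Z => genLyapunov M Z) X := by
      have := contDiffAt_map_inverse (n := ∞) e
      rw [he] at this
      exact this.comp X (contDiff_lyapunovMap M).contDiffAt
    exact ((contDiffAt_const.clm_comp h1).const_smul (1 / 2 : ℝ)).contDiffWithinAt

/-- `π(P) = M^{1/2} P Pᵀ M^{1/2}`, with values in the symmetric matrices. -/
def gbwProj {n : ℕ} (M P : Matrix (Fin n) (Fin n) ℝ) : SymMat n :=
  ⟨CFC.sqrt M * P * Pᵀ * CFC.sqrt M, by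
    have h : (CFC.sqrt M)ᵀ = CFC.sqrt M := by
      simpa using (Matrix.nonneg_iff_posSemidef.1 (CFC.sqrt_nonneg M)).isHermitian.eq
    change (CFC.sqrt M * P * Pᵀ * CFC.sqrt M)ᵀ = _
    simp only [Matrix.transpose_mul, h, Matrix.transpose_transpose, Matrix.mul_assoc]⟩

/-- The horizontal space at `P` of the map `gbwProj M`: the orthogonal complement of the kernel of
its differential, for the Euclidean inner product `⟨U, V⟩ = tr (Uᵀ V)`. -/
def gbwHorizontal {n : ℕ} (M P : Matrix (Fin n) (Fin n) ℝ) : Set (Matrix (Fin n) (Fin n) ℝ) :=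
  {V | ∀ U, fderiv ℝ (gbwProj M) P U = 0 → (Uᵀ * V).trace = 0}

/-- The orthogonal polar factor `A (Aᵀ A)^{-1/2}` of an invertible matrix `A`. -/
def orthogonalPolarFactor {n : ℕ} (A : Matrix (Fin n) (Fin n) ℝ) : Matrix (Fin n) (Fin n) ℝ :=
  A * (CFC.sqrt (Aᵀ * A))⁻¹

end

/-! The map π carries straight lines with horizontal velocity to geodesics; this is checked on the
geodesic equation itself, not through submersion theory. Write S = M^{1/2}. If PᵀV is symmetric,
then V = HP with H symmetric, and at X = π(P) the Lyapunov solution for U = Dπ(P)V is L = S⁻¹HS⁻¹.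
Since Γ_X(U,U) = -2MLXLM (`christoffel_gbwMetric_self`), this equals -2SVVᵀS. As π is quadratic, the
projected line has acceleration 2SVVᵀS, and the two cancel (`gbwPolar_add_christoffel`).

The factor O is chosen so that the end points P₀, P₁ of c satisfy P₀ᵀP₁ = AᵀO = (AᵀA)^{1/2}.
Symmetry of this matrix makes c(t)ᵀc'(t) symmetric, so c' is horizontal; its positivity makes
P₀ᵀc(t) positive definite, so c(t) is invertible. -/

noncomputable section

/-! ### Matrix square roots and the polar decomposition. -/

section SquareRoots

variable {n : ℕ}

theorem transpose_sqrt (M : Matrix (Fin n) (Fin n) ℝ) : (CFC.sqrt M)ᵀ = CFC.sqrt M := by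
  simpa using (Matrix.nonneg_iff_posSemidef.1 (CFC.sqrt_nonneg M)).isHermitian.eq

theorem sqrt_mul_sqrt_of_posDef {M : Matrix (Fin n) (Fin n) ℝ} (hM : M.PosDef) :
    CFC.sqrt M * CFC.sqrt M = M :=
  CFC.sqrt_mul_sqrt_self _ hM.posSemidef.nonneg

theorem isUnit_sqrt_of_posDef {M : Matrix (Fin n) (Fin n) ℝ} (hM : M.PosDef) :
    IsUnit (CFC.sqrt M) :=
  isUnit_of_mul_isUnit_left ((sqrt_mul_sqrt_of_posDef hM).symm ▸ hM.isUnit)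

theorem posDef_sqrt {M : Matrix (Fin n) (Fin n) ℝ} (hM : M.PosDef) : (CFC.sqrt M).PosDef :=
  (Matrix.nonneg_iff_posSemidef.1 (CFC.sqrt_nonneg M)).posDef_iff_isUnit.2
    (isUnit_sqrt_of_posDef hM)

theorem posDef_transpose_mul_self {A : Matrix (Fin n) (Fin n) ℝ} (hA : IsUnit A) :
    (Aᵀ * A).PosDef := by
  have h := Matrix.posSemidef_conjTranspose_mul_self A
  rw [Matrix.conjTranspose_eq_transpose_of_trivial] at h
  exact h.posDef_iff_isUnit.2 (((Matrix.isUnit_transpose A).2 hA).mul hA)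

theorem orthogonalPolarFactor_mul_sqrt {A : Matrix (Fin n) (Fin n) ℝ} (hA : IsUnit A) :
    orthogonalPolarFactor A * CFC.sqrt (Aᵀ * A) = A := by
  have hu := (Matrix.isUnit_iff_isUnit_det _).1
    (isUnit_sqrt_of_posDef (posDef_transpose_mul_self hA))
  rw [orthogonalPolarFactor, Matrix.mul_assoc, Matrix.nonsing_inv_mul _ hu, Matrix.mul_one]

theorem transpose_mul_orthogonalPolarFactor {A : Matrix (Fin n) (Fin n) ℝ} (hA : IsUnit A) :
    Aᵀ * orthogonalPolarFactor A = CFC.sqrt (Aᵀ * A) := by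
  have hP := posDef_transpose_mul_self hA
  have hu := (Matrix.isUnit_iff_isUnit_det _).1 (isUnit_sqrt_of_posDef hP)
  rw [orthogonalPolarFactor, ← Matrix.mul_assoc]
  nth_rewrite 1 [← sqrt_mul_sqrt_of_posDef hP]
  rw [Matrix.mul_assoc, Matrix.mul_nonsing_inv _ hu, Matrix.mul_one]

theorem orthogonalPolarFactor_mem_orthogonalGroup {A : Matrix (Fin n) (Fin n) ℝ}
    (hA : IsUnit A) : orthogonalPolarFactor A ∈ Matrix.orthogonalGroup (Fin n) ℝ := by
  have hu := (Matrix.isUnit_iff_isUnit_det _).1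
    (isUnit_sqrt_of_posDef (posDef_transpose_mul_self hA))
  rw [Matrix.mem_orthogonalGroup_iff']
  nth_rewrite 1 [orthogonalPolarFactor]
  rw [Matrix.transpose_mul, Matrix.transpose_nonsing_inv, transpose_sqrt, Matrix.mul_assoc,
    transpose_mul_orthogonalPolarFactor hA, Matrix.nonsing_inv_mul _ hu]

end SquareRoots

/-! ### Christoffel symbols on the diagonal and derivatives of a metric. -/

namespace OpenRiemannianMetric

variable {E : Type*} [NormedAddCommGroup E] [NormedSpace ℝ E] [FiniteDimensional ℝ E]
  {U : TopologicalSpace.Opens E}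

/-- The derivative `∂_z g (v, w)` of the metric at the point `x`. -/
def derivInner (g : OpenRiemannianMetric U) (x z v w : E) : ℝ :=
  fderiv ℝ g.inner x z v w

/-- The geodesic equation involves Γ only on the diagonal, where two of the three derivative terms
coincide. -/
theorem inner_christoffel_self (g : OpenRiemannianMetric U) {x : E} (hx : x ∈ U) (u w : E) :
    g.inner x (g.christoffel x u u) w =
      g.derivInner x u u w - (1 / 2) * g.derivInner x w u u := by
  rw [g.inner_christoffel hx, derivInner, derivInner]
  ring

/-- If `g_x (v, f x)` is constant on `U`, then `∂_z g (v, f x) = -g_x (v, f z)`. -/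
theorem derivInner_of_inner_eq_const (g : OpenRiemannianMetric U) {x : E} (hx : x ∈ U)
    (v : E) (f : E →ₗ[ℝ] E) (r : ℝ) (h : ∀ y ∈ U, g.inner y v (f y) = r) (z : E) :
    g.derivInner x z v (f x) = -g.inner x v (f z) := by
  have hopen : (U : Set E) ∈ nhds x := U.isOpen.mem_nhds hx
  have hg : HasFDerivAt g.inner (fderiv ℝ g.inner x) x :=
    (((g.smooth x hx).contDiffAt hopen).differentiableAt (by simp)).hasFDerivAt
  have hf : HasFDerivAt f (LinearMap.toContinuousLinearMap f) x :=
    (LinearMap.toContinuousLinearMap f).hasFDerivAt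
  -- Product rule: the derivative is the sum of a term differentiating the metric and a term
  -- differentiating f; constancy makes it vanish.
  have h1 := (hg.clm_apply (hasFDerivAt_const v x)).clm_apply hf
  have h2 : (fun y => g.inner y v (f y)) =ᶠ[nhds x] fun _ => r := by
    filter_upwards [hopen] with y hy using h y hy
  have h3 := h1.unique ((hasFDerivAt_const r x).congr_of_eventuallyEq h2)
  have h4 := congrArg (fun φ : E →L[ℝ] ℝ => φ z) h3
  have h5 : g.inner x v (f z) + g.derivInner x z v (f x) = 0 := by
    simpa [derivInner] using h4
  linarith

end OpenRiemannianMetric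

/-! ### Calculus of quadratic maps. -/

section QuadraticMaps

variable {E F : Type*} [NormedAddCommGroup E] [NormedSpace ℝ E] [NormedAddCommGroup F]
  [NormedSpace ℝ F]

theorem hasFDerivAt_half_smul_bilin (B : E →L[ℝ] E →L[ℝ] F) (hB : ∀ u v, B u v = B v u) (x : E) :
    HasFDerivAt (fun x => (1 / 2 : ℝ) • B x x) (B x) x := by
  refine ((B.hasFDerivAt.clm_apply (hasFDerivAt_id x)).const_smul (1 / 2 : ℝ)).congr_fderiv ?_
  ext1 u
  have h : (1 / 2 : ℝ) • (B x u + B u x) = B x u := by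
    rw [hB u x]
    module
  simpa using h

theorem contDiff_half_smul_bilin (B : E →L[ℝ] E →L[ℝ] F) :
    ContDiff ℝ ∞ fun x => (1 / 2 : ℝ) • B x x :=
  (B.contDiff.clm_apply contDiff_id).const_smul _

theorem hasDerivAt_bilin_left (B : E →L[ℝ] E →L[ℝ] F) (v : E) {c : ℝ → E} {c' : E} {t : ℝ}
    (hc : HasDerivAt c c' t) : HasDerivAt (fun t => B (c t) v) (B c' v) t :=
  (B.flip v).hasFDerivAt.comp_hasDerivAt t hc

end QuadraticMaps

/-! ### Christoffel symbols of the GBW metric. -/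

section Christoffel

variable {n : ℕ}

/-- The derivative of the generalized Bures-Wasserstein metric. -/
theorem derivInner_gbwMetric {M X : SymMat n} (hM : M.1.PosDef) (hX : X.1.PosDef)
    (Z U W : SymMat n) :
    (gbwMetric M hM).derivInner X Z U W = -((1 / 2) * ((genLyapunov M X U).1 *
      (Z.1 * (genLyapunov M X W).1 * M.1 + M.1 * (genLyapunov M X W).1 * Z.1)).trace) := by
  -- Differentiating the inverse operator is avoided: L is frozen, and W is extended to the linear
  -- field f(Z) = ZLM + MLZ, whose Lyapunov solution at every Z is L. Hence g_Z(U, f(Z)) is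
  -- constant.
  set L := genLyapunov M X W with hL
  let f : SymMat n →ₗ[ℝ] SymMat n :=
    { toFun := fun X => lyapunovMap M X L
      map_add' := fun A B => by
        ext1
        change (A.1 + B.1) * L.1 * M.1 + M.1 * L.1 * (A.1 + B.1) =
          (A.1 * L.1 * M.1 + M.1 * L.1 * A.1) + (B.1 * L.1 * M.1 + M.1 * L.1 * B.1)
        simp only [Matrix.mul_add, Matrix.add_mul]
        abel
      map_smul' := fun c A => by
        ext1
        change (c • A.1) * L.1 * M.1 + M.1 * L.1 * (c • A.1) =
          c • (A.1 * L.1 * M.1 + M.1 * L.1 * A.1)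
        simp [smul_add] }
  have hLW : f X = W := (lyapunovMap_isInvertible hM hX).self_apply_inverse W
  have h := (gbwMetric M hM).derivInner_of_inner_eq_const hX U f ((1 / 2) * (L.1 * U.1).trace)
    (fun Z hZ => by
      have hinv : genLyapunov M Z (f Z) = L :=
        (lyapunovMap_isInvertible hM hZ).inverse_apply_self L
      rw [(gbwMetric M hM).symm Z hZ]
      change gbwForm M Z (f Z) U = _
      rw [gbwForm_apply, hinv]) Z
  rw [hLW] at h
  exact h

/-- The Christoffel symbols of the generalized Bures-Wasserstein metric on the diagonal:
`Γ_X(U, U) = -2 M L X L M` with `L = 𝓛_{X,M}[U]`. -/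
theorem christoffel_gbwMetric_self {M X : SymMat n} (hM : M.1.PosDef) (hX : X.1.PosDef)
    (U : SymMat n) : ((gbwMetric M hM).christoffel X U U).1 =
      -((2 : ℝ) • (M.1 * (genLyapunov M X U).1 * X.1 * (genLyapunov M X U).1 * M.1)) := by
  set L := genLyapunov M X U with hL
  have hXt : X.1ᵀ = X.1 := X.2
  have hMt : M.1ᵀ = M.1 := M.2
  have hLt : L.1ᵀ = L.1 := L.2
  let G : SymMat n := ⟨-((2 : ℝ) • (M.1 * L.1 * X.1 * L.1 * M.1)), by
    change (-((2 : ℝ) • (M.1 * L.1 * X.1 * L.1 * M.1)))ᵀ = _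
    simp only [Matrix.transpose_neg, Matrix.transpose_smul, Matrix.transpose_mul, hXt, hMt, hLt,
      Matrix.mul_assoc]⟩
  -- By definiteness, it suffices that the difference W from the claimed value has g_X(W, W) = 0.
  suffices h : (gbwMetric M hM).christoffel X U U - G = 0 from congrArg Subtype.val (sub_eq_zero.1 h)
  by_contra h0
  refine ((gbwMetric M hM).pos X hX _ h0).ne' ?_
  generalize hW : (gbwMetric M hM).christoffel X U U - G = W
  nth_rewrite 1 [← hW]
  rw [map_sub, sub_apply, (gbwMetric M hM).inner_christoffel_self hX]
  have hG : (gbwMetric M hM).inner X G W = (1 / 2) * ((genLyapunov M X W).1 * G.1).trace := by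
    rw [(gbwMetric M hM).symm X hX]
    rfl
  rw [hG, derivInner_gbwMetric hM hX, derivInner_gbwMetric hM hX]
  have hU := lyapunovMap_genLyapunov hM hX U
  have hWW := lyapunovMap_genLyapunov hM hX W
  rw [← hL] at hU ⊢
  set K := genLyapunov M X W
  rw [← hU, ← hWW, show G.1 = -((2 : ℝ) • (M.1 * L.1 * X.1 * L.1 * M.1)) from rfl]
  -- Cyclic rotation puts K first in every trace, so that equal terms become syntactically equal.
  have cyc : ∀ A B : Matrix (Fin n) (Fin n) ℝ, (A * (K.1 * B)).trace = (K.1 * (B * A)).trace :=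
    fun A B => by rw [Matrix.trace_mul_comm, Matrix.mul_assoc]
  have t1 := cyc (L.1 * X.1 * L.1 * M.1) M.1
  have t2 := cyc (L.1 * M.1 * L.1 * X.1) M.1
  have t3 := cyc (L.1 * M.1) (X.1 * L.1 * M.1)
  have t4 := cyc (L.1 * M.1) (M.1 * L.1 * X.1)
  have t5 := cyc (L.1 * X.1) (M.1 * L.1 * M.1)
  have t6 := cyc (L.1 * M.1 * L.1 * M.1) X.1
  simp only [Matrix.mul_assoc] at t1 t2 t3 t4 t5 t6
  simp only [Matrix.mul_add, Matrix.add_mul, Matrix.trace_add, Matrix.mul_assoc, Matrix.mul_neg,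
    Matrix.mul_smul, Matrix.trace_neg, Matrix.trace_smul, smul_eq_mul, t1, t2, t3, t4, t5, t6]
  ring

end Christoffel

/-! ### The projection π, horizontal vectors and projected segments. -/

section Submersion

variable {n : ℕ}

/-- The polarization `(P, Q) ↦ M^{1/2} (P Qᵀ + Q Pᵀ) M^{1/2}` of `gbwProj M`. -/
def gbwPolar (M : Matrix (Fin n) (Fin n) ℝ) : Matrix (Fin n) (Fin n) ℝ →L[ℝ]
    Matrix (Fin n) (Fin n) ℝ →L[ℝ] SymMat n :=
  LinearMap.toContinuousBilinearMap
    (LinearMap.mk₂ ℝ (fun P Q => ⟨CFC.sqrt M * (P * Qᵀ + Q * Pᵀ) * CFC.sqrt M, by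
        change (CFC.sqrt M * (P * Qᵀ + Q * Pᵀ) * CFC.sqrt M)ᵀ = _
        simp only [Matrix.transpose_mul, Matrix.transpose_add, transpose_sqrt,
          Matrix.transpose_transpose, Matrix.mul_assoc, add_comm]⟩)
      (fun _ _ _ => by
        ext1
        simp only [Submodule.coe_add, Matrix.transpose_add, Matrix.mul_add, Matrix.add_mul]
        abel)
      (fun _ _ _ => by ext1; simp [Matrix.mul_add, Matrix.add_mul])
      (fun _ _ _ => by
        ext1
        simp only [Submodule.coe_add, Matrix.transpose_add, Matrix.mul_add, Matrix.add_mul]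
        abel)
      (fun _ _ _ => by ext1; simp [Matrix.mul_add, Matrix.add_mul]))

theorem gbwPolar_coe (M P Q : Matrix (Fin n) (Fin n) ℝ) :
    (gbwPolar M P Q).1 = CFC.sqrt M * (P * Qᵀ + Q * Pᵀ) * CFC.sqrt M := rfl

theorem gbwPolar_comm (M P Q : Matrix (Fin n) (Fin n) ℝ) : gbwPolar M P Q = gbwPolar M Q P := by
  ext1
  rw [gbwPolar_coe, gbwPolar_coe, add_comm]

theorem gbwProj_eq_gbwPolar (M P : Matrix (Fin n) (Fin n) ℝ) :
    gbwProj M P = (1 / 2 : ℝ) • gbwPolar M P P := by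
  ext1
  rw [Submodule.coe_smul, gbwPolar_coe, ← two_smul ℝ (P * Pᵀ), Matrix.mul_smul, Matrix.smul_mul,
    smul_smul]
  norm_num [gbwProj, Matrix.mul_assoc]

theorem hasFDerivAt_gbwProj (M P : Matrix (Fin n) (Fin n) ℝ) :
    HasFDerivAt (gbwProj M) (gbwPolar M P) P := by
  rw [show gbwProj M = fun P => (1 / 2 : ℝ) • gbwPolar M P P from
    funext (gbwProj_eq_gbwPolar M)]
  exact hasFDerivAt_half_smul_bilin _ (gbwPolar_comm M) P

theorem contDiff_gbwProj (M : Matrix (Fin n) (Fin n) ℝ) : ContDiff ℝ ∞ (gbwProj M) := by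
  rw [show gbwProj M = fun P => (1 / 2 : ℝ) • gbwPolar M P P from
    funext (gbwProj_eq_gbwPolar M)]
  exact contDiff_half_smul_bilin (gbwPolar M)

/-- VP⁻¹ is congruent to PᵀV through P⁻¹. -/
theorem isSymm_mul_inv {P V : Matrix (Fin n) (Fin n) ℝ} (hP : IsUnit P)
    (h : (Pᵀ * V).IsSymm) : (V * P⁻¹).IsSymm := by
  have hd := (Matrix.isUnit_iff_isUnit_det _).1 hP
  have hdt := (Matrix.isUnit_iff_isUnit_det _).1 ((Matrix.isUnit_transpose P).2 hP)
  have h1 : V * P⁻¹ = (P⁻¹)ᵀ * (Pᵀ * V) * P⁻¹ := by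
    rw [Matrix.transpose_nonsing_inv, ← Matrix.mul_assoc, Matrix.nonsing_inv_mul _ hdt,
      Matrix.one_mul]
  rw [Matrix.IsSymm, h1, Matrix.transpose_mul, Matrix.transpose_mul, h.eq,
    Matrix.transpose_transpose, Matrix.mul_assoc (P⁻¹)ᵀ]

/-- For U in the kernel, PUᵀ is skew. With V = HP, tr(UᵀV) = tr(PUᵀH) pairs a skew matrix with a
symmetric one, hence vanishes. -/
theorem mem_gbwHorizontal {M P V : Matrix (Fin n) (Fin n) ℝ} (hM : M.PosDef) (hP : IsUnit P)
    (h : (Pᵀ * V).IsSymm) : V ∈ gbwHorizontal M P := by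
  intro U hU
  rw [(hasFDerivAt_gbwProj M P).fderiv] at hU
  have hS := isUnit_sqrt_of_posDef hM
  have hd := (Matrix.isUnit_iff_isUnit_det _).1 hP
  have h1 : CFC.sqrt M * (P * Uᵀ + U * Pᵀ) * CFC.sqrt M = 0 := congrArg Subtype.val hU
  have h2 : P * Uᵀ = -(U * Pᵀ) :=
    eq_neg_of_add_eq_zero_left (hS.mul_right_eq_zero.1 (hS.mul_left_eq_zero.1 h1))
  obtain ⟨H, hH, hV⟩ : ∃ H : Matrix (Fin n) (Fin n) ℝ, Hᵀ = H ∧ V = H * P :=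
    ⟨V * P⁻¹, isSymm_mul_inv hP h, by
      rw [Matrix.mul_assoc, Matrix.nonsing_inv_mul _ hd, Matrix.mul_one]⟩
  have h3 : (Uᵀ * V).trace = (P * Uᵀ * H).trace := by
    rw [hV, ← Matrix.mul_assoc, Matrix.trace_mul_comm, Matrix.mul_assoc]
  have h4 : (P * Uᵀ * H).trace = (U * Pᵀ * H).trace := by
    rw [← Matrix.trace_transpose, Matrix.trace_mul_comm (U * Pᵀ)]
    simp only [Matrix.transpose_mul, hH, Matrix.transpose_transpose, Matrix.mul_assoc]
  rw [h2, Matrix.neg_mul, Matrix.trace_neg] at h4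
  rw [h3, h2, Matrix.neg_mul, Matrix.trace_neg]
  linarith

theorem posDef_gbwProj {M P : Matrix (Fin n) (Fin n) ℝ} (hM : M.PosDef) (hP : IsUnit P) :
    (gbwProj M P).1.PosDef := by
  have h := posDef_transpose_mul_self
    (((Matrix.isUnit_transpose P).2 hP).mul (isUnit_sqrt_of_posDef hM))
  have h1 : (Pᵀ * CFC.sqrt M)ᵀ * (Pᵀ * CFC.sqrt M) = (gbwProj M P).1 := by
    rw [Matrix.transpose_mul, transpose_sqrt, Matrix.transpose_transpose, ← Matrix.mul_assoc]
    rfl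
  rwa [h1] at h

/-- Acceleration of the projection of a straight line with horizontal velocity. -/
theorem gbwPolar_add_christoffel {M : SymMat n} {P V : Matrix (Fin n) (Fin n) ℝ}
    (hM : M.1.PosDef) (hP : IsUnit P) (h : (Pᵀ * V).IsSymm) :
    gbwPolar M.1 V V + (gbwMetric M hM).christoffel (gbwProj M.1 P) (gbwPolar M.1 P V)
      (gbwPolar M.1 P V) = 0 := by
  have hd := (Matrix.isUnit_iff_isUnit_det _).1 hP
  have hX := posDef_gbwProj hM hP
  have hSS := sqrt_mul_sqrt_of_posDef hM
  have hSt := transpose_sqrt M.1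
  have hSd := (Matrix.isUnit_iff_isUnit_det _).1 (isUnit_sqrt_of_posDef hM)
  obtain ⟨H, hH, hV⟩ : ∃ H : Matrix (Fin n) (Fin n) ℝ, Hᵀ = H ∧ V = H * P :=
    ⟨V * P⁻¹, isSymm_mul_inv hP h, by
      rw [Matrix.mul_assoc, Matrix.nonsing_inv_mul _ hd, Matrix.mul_one]⟩
  set S := CFC.sqrt M.1 with hS
  -- With X = SPPᵀS and V = HP, this L satisfies MLS = SH and SLM = HS, so XLM + MLX = S(PVᵀ +
  -- VPᵀ)S.
  let L : SymMat n := ⟨S⁻¹ * H * S⁻¹, by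
    change (S⁻¹ * H * S⁻¹)ᵀ = _
    simp only [Matrix.transpose_mul, Matrix.transpose_nonsing_inv, hSt, hH, Matrix.mul_assoc]⟩
  have hproj : (gbwProj M.1 P).1 = S * P * Pᵀ * S := rfl
  have e1 : S * (L.1 * S) = H := by
    change S * (S⁻¹ * H * S⁻¹ * S) = H
    rw [Matrix.nonsing_inv_mul_cancel_right _ _ hSd, Matrix.mul_nonsing_inv_cancel_left _ _ hSd]
  have e2 : M.1 * L.1 * S = S * H := by
    rw [← hSS, Matrix.mul_assoc, Matrix.mul_assoc, e1]
  have e3 : S * L.1 * M.1 = H * S := by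
    rw [← hSS, ← Matrix.mul_assoc, Matrix.mul_assoc S, e1]
  have hL : genLyapunov M (gbwProj M.1 P) (gbwPolar M.1 P V) = L := by
    have h1 : lyapunovMap M (gbwProj M.1 P) L = gbwPolar M.1 P V := by
      ext1
      change (gbwProj M.1 P).1 * L.1 * M.1 + M.1 * L.1 * (gbwProj M.1 P).1 = _
      rw [hproj, gbwPolar_coe, ← hS, hV,
        show S * P * Pᵀ * S * L.1 * M.1 = S * P * Pᵀ * (S * L.1 * M.1) by
          simp only [Matrix.mul_assoc], e3,
        show M.1 * L.1 * (S * P * Pᵀ * S) = (M.1 * L.1 * S) * (P * Pᵀ * S) by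
          simp only [Matrix.mul_assoc], e2]
      simp only [Matrix.transpose_mul, hH, Matrix.mul_add, Matrix.add_mul, Matrix.mul_assoc]
    rw [← h1]
    exact (lyapunovMap_isInvertible hM hX).inverse_apply_self L
  ext1
  rw [Submodule.coe_add, christoffel_gbwMetric_self hM hX, hL, hproj, gbwPolar_coe, ← hS,
    show M.1 * L.1 * (S * P * Pᵀ * S) * L.1 * M.1 = (M.1 * L.1 * S) * (P * Pᵀ) * (S * L.1 * M.1) by
      simp only [Matrix.mul_assoc], e2, e3, ← two_smul ℝ (V * Vᵀ), hV]
  simp only [Matrix.transpose_mul, hH, Matrix.mul_smul, Matrix.smul_mul, Matrix.mul_assoc,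
    add_neg_cancel, Submodule.coe_zero]

/-- The projection of a segment of invertible matrices with horizontal velocity is a geodesic. -/
theorem isGeodesicOn_gbwProj_segment {M : SymMat n} (hM : M.1.PosDef)
    {P Q : Matrix (Fin n) (Fin n) ℝ}
    (hu : ∀ t ∈ Set.Icc (0 : ℝ) 1, IsUnit ((1 - t) • P + t • Q))
    (hs : ∀ t ∈ Set.Icc (0 : ℝ) 1, (((1 - t) • P + t • Q)ᵀ * (Q - P)).IsSymm) :
    (gbwMetric M hM).IsGeodesicOn (fun t => gbwProj M.1 ((1 - t) • P + t • Q))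
      (Set.Icc 0 1) := by
  have hc : ∀ t : ℝ, HasDerivAt (fun t : ℝ => (1 - t) • P + t • Q) (Q - P) t := fun t => by
    have := (((hasDerivAt_id t).const_sub 1).smul_const P).add ((hasDerivAt_id t).smul_const Q)
    refine this.congr_deriv ?_
    module
  have hγ : ∀ t : ℝ, HasDerivAt (fun t : ℝ => gbwProj M.1 ((1 - t) • P + t • Q))
      (gbwPolar M.1 ((1 - t) • P + t • Q) (Q - P)) t := fun t =>
    (hasFDerivAt_gbwProj M.1 _).comp_hasDerivAt t (hc t)
  have hγ' : ∀ t : ℝ, HasDerivAt (fun t : ℝ => gbwPolar M.1 ((1 - t) • P + t • Q) (Q - P))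
      (gbwPolar M.1 (Q - P) (Q - P)) t := fun t =>
    hasDerivAt_bilin_left (gbwPolar M.1) (Q - P) (hc t)
  have hun := uniqueDiffOn_Icc (zero_lt_one' ℝ)
  have h1 : ∀ t ∈ Set.Icc (0 : ℝ) 1,
      derivWithin (fun t : ℝ => gbwProj M.1 ((1 - t) • P + t • Q)) (Set.Icc 0 1) t =
        gbwPolar M.1 ((1 - t) • P + t • Q) (Q - P) := fun t ht =>
    (hγ t).hasDerivWithinAt.derivWithin (hun t ht)
  refine ⟨fun t ht => posDef_gbwProj hM (hu t ht), ?_, fun t ht => ?_⟩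
  · refine ((contDiff_gbwProj M.1).comp (g := gbwProj M.1) ?_).contDiffOn
    fun_prop
  · rw [derivWithin_congr h1 (h1 t ht), h1 t ht,
      (hγ' t).hasDerivWithinAt.derivWithin (hun t ht)]
    exact gbwPolar_add_christoffel hM (hu t ht) (hs t ht)

end Submersion

end

/-! ### The segment between lifts of X and Y. -/

theorem mainTheorem3 (n : ℕ) (M X Y : SymMat n) (hM : M.1.PosDef) (hX : X.1.PosDef)
    (hY : Y.1.PosDef) :
    let A : Matrix (Fin n) (Fin n) ℝ := CFC.sqrt Y.1 * M.1⁻¹ * CFC.sqrt X.1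
    let O : Matrix (Fin n) (Fin n) ℝ := orthogonalPolarFactor A
    let c : ℝ → Matrix (Fin n) (Fin n) ℝ := fun t =>
      (1 - t) • ((CFC.sqrt M.1)⁻¹ * CFC.sqrt X.1) + t • ((CFC.sqrt M.1)⁻¹ * CFC.sqrt Y.1 * O)
    let γ : ℝ → SymMat n := fun t => gbwProj M.1 (c t)
    (O ∈ Matrix.orthogonalGroup (Fin n) ℝ ∧
      ∃ P : Matrix (Fin n) (Fin n) ℝ, P.PosDef ∧ A = O * P) ∧
    (∀ t ∈ Set.Icc (0 : ℝ) 1, IsUnit (c t) ∧ deriv c t ∈ gbwHorizontal M.1 (c t)) ∧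
    (gbwMetric M hM).IsGeodesicOn γ (Set.Icc 0 1) ∧ γ 0 = X ∧ γ 1 = Y ∧
    (∀ t : ℝ, (γ t : Matrix (Fin n) (Fin n) ℝ) =
      ((1 - t) • CFC.sqrt X.1 + t • (CFC.sqrt Y.1 * O)) *
        ((1 - t) • CFC.sqrt X.1 + t • (CFC.sqrt Y.1 * O))ᵀ) := by
  intro A O c γ
  have hSu := isUnit_sqrt_of_posDef hM
  have hSd := (Matrix.isUnit_iff_isUnit_det _).1 hSu
  have hSt := transpose_sqrt M.1
  have hRX := isUnit_sqrt_of_posDef hX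
  have hA : IsUnit A := ((isUnit_sqrt_of_posDef hY).mul
    (Matrix.isUnit_nonsing_inv_iff.2 hM.isUnit)).mul hRX
  have hP := posDef_sqrt (posDef_transpose_mul_self hA)
  have hO : O ∈ Matrix.orthogonalGroup (Fin n) ℝ := orthogonalPolarFactor_mem_orthogonalGroup hA
  have hOO : O * Oᵀ = 1 := (Matrix.mem_orthogonalGroup_iff _ _).1 hO
  set S := CFC.sqrt M.1 with hS
  set P₀ := S⁻¹ * CFC.sqrt X.1 with hP₀
  set P₁ := S⁻¹ * CFC.sqrt Y.1 * O with hP₁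
  have hP₀u : IsUnit P₀ := (Matrix.isUnit_nonsing_inv_iff.2 hSu).mul hRX
  have hS2 : S⁻¹ * S⁻¹ = M.1⁻¹ := by
    rw [← Matrix.mul_inv_rev, sqrt_mul_sqrt_of_posDef hM]
  have h01 : P₀ᵀ * P₁ = CFC.sqrt (Aᵀ * A) := by
    rw [← transpose_mul_orthogonalPolarFactor hA, hP₀, hP₁]
    change _ = (CFC.sqrt Y.1 * M.1⁻¹ * CFC.sqrt X.1)ᵀ * O
    simp only [Matrix.transpose_mul, Matrix.transpose_nonsing_inv, hSt, transpose_sqrt, ← hS2,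
      Matrix.mul_assoc]
  have h01s : P₁ᵀ * P₀ = P₀ᵀ * P₁ := by
    have h := congrArg Matrix.transpose h01
    rwa [transpose_sqrt, ← h01, Matrix.transpose_mul, Matrix.transpose_transpose] at h
  have hct : ∀ t : ℝ, c t = (1 - t) • P₀ + t • P₁ := fun _ => rfl
  have hcu : ∀ t ∈ Set.Icc (0 : ℝ) 1, IsUnit (c t) := fun t ht => by
    have h1 : P₀ᵀ * c t = (1 - t) • (P₀ᵀ * P₀) + t • CFC.sqrt (Aᵀ * A) := by
      rw [← h01]
      simp only [hct, Matrix.mul_add, Matrix.mul_smul]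
    have h2 : (P₀ᵀ * c t).PosDef := by
      rw [h1]
      have h0 := posDef_transpose_mul_self hP₀u
      -- At t = 0 definiteness comes from P₀ᵀP₀; for t > 0 it comes from the square root, the first
      -- term being only semidefinite at t = 1.
      rcases ht.1.eq_or_lt with rfl | h
      · simpa using h0
      · exact Matrix.PosDef.posSemidef_add (h0.posSemidef.smul (sub_nonneg.2 ht.2)) (hP.smul h)
    exact isUnit_of_mul_isUnit_right h2.isUnit
  have hcs : ∀ t : ℝ, ((c t)ᵀ * (P₁ - P₀)).IsSymm := fun t => by
    simp only [hct, Matrix.IsSymm, Matrix.transpose_add, Matrix.transpose_smul, Matrix.transpose_mul,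
      Matrix.transpose_sub, Matrix.transpose_transpose, Matrix.add_mul,
      Matrix.mul_sub, Matrix.smul_mul, h01s]
  have hcd : ∀ t : ℝ, deriv c t = P₁ - P₀ := fun t => by
    have := (((hasDerivAt_id t).const_sub 1).smul_const P₀).add ((hasDerivAt_id t).smul_const P₁)
    refine this.deriv.trans ?_
    module
  have hform : ∀ t : ℝ, (γ t : Matrix (Fin n) (Fin n) ℝ) =
      ((1 - t) • CFC.sqrt X.1 + t • (CFC.sqrt Y.1 * O)) *
        ((1 - t) • CFC.sqrt X.1 + t • (CFC.sqrt Y.1 * O))ᵀ := fun t => by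
    have h1 : S * c t = (1 - t) • CFC.sqrt X.1 + t • (CFC.sqrt Y.1 * O) := by
      simp only [hct, hP₀, hP₁, Matrix.mul_add, Matrix.mul_smul, Matrix.mul_assoc,
        Matrix.mul_nonsing_inv_cancel_left _ _ hSd]
    rw [← h1, Matrix.transpose_mul, hSt, ← Matrix.mul_assoc]
    rfl
  refine ⟨⟨hO, _, hP, (orthogonalPolarFactor_mul_sqrt hA).symm⟩, fun t ht => ⟨hcu t ht, ?_⟩,
    isGeodesicOn_gbwProj_segment hM hcu fun t _ => hcs t, ?_, ?_, hform⟩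
  · rw [hcd]
    exact mem_gbwHorizontal hM (hcu t ht) (hcs t)
  · ext1
    rw [hform]
    simp [transpose_sqrt, sqrt_mul_sqrt_of_posDef hX]
  · ext1
    rw [hform]
    simp only [sub_self, zero_smul, zero_add, one_smul, Matrix.transpose_mul, transpose_sqrt]
    rw [Matrix.mul_assoc, ← Matrix.mul_assoc O, hOO, Matrix.one_mul, sqrt_mul_sqrt_of_posDef hY]
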